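/- \textbf{Theorem.} If there is an algorithm that enumerates, with polynomial delay, all minimal connected dominating sets of a given split graph, then there is an algorithm that enumerates, with polynomial delay, all minimal hitting sets of a given hypergraph. Here graphs are finite, simple and undirected; $G=(V,E)$ is a \emph{split graph} if $V$ is the union of a clique and an independent set; $D\subseteq V$ is a \emph{connected dominating set} if every vertex of $V$ lies in $D$ or has a neighbour in $D$ and the induced subgraph $G[D]$ is connected (in particular $D\neq\emptyset$). A hypergraph is a pair $(X,\mathcal S)$ with $X$ finite and $\mathcal S\subseteq 2^X$; $H\subseteq X$ is a \emph{hitting set} if $H\cap S\ne\emptyset$ for all $S\in\mathcal S$. \emph{Minimal} means inclusion-minimal. Graphs are given with $V=\{0,\dots,n-1\}$ by $n$ and the adjacency matrix, hypergraphs with $X=\{0,\dots,n-1\}$ by $n$, $|\mathcal S|$ and the incidence matrix (with the edges listed in any order). An algorithm is a program for a random access machine with addition, truncated subtraction, multiplication and indirect addressing, under the logarithmic cost criterion. It \emph{enumerates} the solutions of an instance if it outputs each solution exactly once (as a list of its elements), outputs nothing else, and then halts. It does so \emph{with polynomial delay} if there is a polynomial $p$ such that on every instance the time before the first output, the time between any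 two consecutive outputs, and the time from the last output until halting (the whole running time, if there is no output) are at most $p(|V|)$ for a graph $G=(V,E)$, and at most $p(|X|+|\mathcal S|)$ for a hypergraph $(X,\mathcal S)$. -/

import Mathlib

namespace PolyDelay

/-! ### Random access machines with logarithmic cost

Programs are finite terms. They use number registers `x : ℕ` and arrays `a : ℕ` of numbers
(finitely many of each in every single program), and they write to a write-only output. -/

/-- Programs of a random access machine, written with structured control flow. -/
inductive Prog : Type
  /-- do nothing -/
  | skip : Prog
  /-- `x := k` -/
  | const (x k : ℕ) : Prog
  /-- `x := y + z` -/
  | add (x y z : ℕ) : Prog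
  /-- `x := y - z` (which is `0` if `y < z`) -/
  | sub (x y z : ℕ) : Prog
  /-- `x := y * z` -/
  | mul (x y z : ℕ) : Prog
  /-- `x := a[y]` (indirect addressing) -/
  | load (x a y : ℕ) : Prog
  /-- `a[y] := x` (indirect addressing) -/
  | store (a y x : ℕ) : Prog
  /-- write the content of `x` to the output -/
  | put (x : ℕ) : Prog
  /-- end the current output item -/
  | emit : Prog
  /-- first `c`, then `d` -/
  | seq (c d : Prog) : Prog
  /-- if `x ≠ 0` then `c` else `d` -/
  | ite (x : ℕ) (c d : Prog) : Prog
  /-- while `x ≠ 0` do `c` -/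
  | loop (x : ℕ) (c : Prog) : Prog

/-- The memory of the machine: contents of the registers and of the array cells. -/
structure State where
  reg : ℕ → ℕ
  mem : ℕ → ℕ → ℕ

/-- Assign `v` to the register `x`. -/
def State.setReg (s : State) (x v : ℕ) : State :=
  { s with reg := Function.update s.reg x v }

/-- Assign `v` to the cell `i` of the array `a`. -/
def State.setMem (s : State) (a i v : ℕ) : State :=
  { s with mem := Function.update s.mem a (Function.update (s.mem a) i v) }

/-- The initial memory on the input `f`: the input is in array `0`, and all else is zero. -/
def State.init (f : ℕ → ℕ) : State where
  reg := fun _ => 0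
  mem := fun a => if a = 0 then f else fun _ => 0

/-- What a computation does, seen from outside: it lets time pass, it writes a number to the
output, or it ends the current output item. -/
inductive Action : Type
  | tick (t : ℕ) : Action
  | put (v : ℕ) : Action
  | emit : Action

/-- The logarithmic cost of handling the number `v`: its binary length, plus one. -/
def logCost (v : ℕ) : ℕ := Nat.size v + 1

/-- `Exec c s tr s'`: started in memory `s`, the program `c` halts in memory `s'`, and `tr` is the
sequence of its actions in between. Every instruction costs the sum of the logarithmic
costs of the numbers (operands and addresses) that it handles. -/
inductive Exec : Prog → State → List Action → State → Prop
  | skip (s : State) : Exec .skip s [.tick 1] s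
  | const (s : State) (x k : ℕ) : Exec (.const x k) s [.tick (logCost k)] (s.setReg x k)
  | add (s : State) (x y z : ℕ) :
      Exec (.add x y z) s [.tick (logCost (s.reg y) + logCost (s.reg z))]
        (s.setReg x (s.reg y + s.reg z))
  | sub (s : State) (x y z : ℕ) :
      Exec (.sub x y z) s [.tick (logCost (s.reg y) + logCost (s.reg z))]
        (s.setReg x (s.reg y - s.reg z))
  | mul (s : State) (x y z : ℕ) :
      Exec (.mul x y z) s [.tick (logCost (s.reg y) + logCost (s.reg z))]
        (s.setReg x (s.reg y * s.reg z))
  | load (s : State) (x a y : ℕ) :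
      Exec (.load x a y) s [.tick (logCost (s.reg y) + logCost (s.mem a (s.reg y)))]
        (s.setReg x (s.mem a (s.reg y)))
  | store (s : State) (a y x : ℕ) :
      Exec (.store a y x) s [.tick (logCost (s.reg y) + logCost (s.reg x))]
        (s.setMem a (s.reg y) (s.reg x))
  | put (s : State) (x : ℕ) :
      Exec (.put x) s [.tick (logCost (s.reg x)), .put (s.reg x)] s
  | emit (s : State) : Exec .emit s [.tick 1, .emit] s
  | seq {c d : Prog} {s s' s'' : State} {tr tr' : List Action} :
      Exec c s tr s' → Exec d s' tr' s'' → Exec (.seq c d) s (tr ++ tr') s''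
  | ite_true {x : ℕ} {c d : Prog} {s s' : State} {tr : List Action} :
      s.reg x ≠ 0 → Exec c s tr s' →
        Exec (.ite x c d) s (.tick (logCost (s.reg x)) :: tr) s'
  | ite_false {x : ℕ} {c d : Prog} {s s' : State} {tr : List Action} :
      s.reg x = 0 → Exec d s tr s' →
        Exec (.ite x c d) s (.tick (logCost (s.reg x)) :: tr) s'
  | loop_true {x : ℕ} {c : Prog} {s s' s'' : State} {tr tr' : List Action} :
      s.reg x ≠ 0 → Exec c s tr s' → Exec (.loop x c) s' tr' s'' →
        Exec (.loop x c) s (.tick (logCost (s.reg x)) :: (tr ++ tr')) s''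
  | loop_false {x : ℕ} {c : Prog} {s : State} :
      s.reg x = 0 → Exec (.loop x c) s [.tick (logCost (s.reg x))] s

/-- The sequence of the output items of a run. An item is the list of the numbers written since
the previous item ended; `cur` is the part of the current item that has been written already. -/
def outputs : List ℕ → List Action → List (List ℕ)
  | _, [] => []
  | cur, .tick _ :: tr => outputs cur tr
  | cur, .put v :: tr => outputs (cur ++ [v]) tr
  | cur, .emit :: tr => cur :: outputs [] tr

/-- The delays of a run: the time until the first output item is complete, the times between
consecutive items, and the time from the last item until the machine halts (the whole running time
if there is no output); `t` is the time that has passed already since the last item. -/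
def delays : ℕ → List Action → List ℕ
  | t, [] => [t]
  | t, .tick k :: tr => delays (t + k) tr
  | t, .put _ :: tr => delays t tr
  | t, .emit :: tr => t :: delays 0 tr

/-! ### Enumeration problems and polynomial delay -/

/-- An enumeration problem whose solutions are finite sets of numbers. -/
structure EnumProblem where
  /-- the instances -/
  Inst : Type
  /-- the size of an instance -/
  size : Inst → ℕ
  /-- `IsCode i f`: the instance `i` may be given to a machine as the array `f` -/
  IsCode : Inst → (ℕ → ℕ) → Prop
  /-- the solutions of an instance -/
  sol : Inst → Set (Finset ℕ)

/-- There is an algorithm that enumerates, for every instance (however encoded), all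
solutions, each exactly once (as a list of its elements, in any order, repetitions of an element in
the list being harmless), outputs no other set, then halts, and whose
delays are all bounded by a polynomial in the size of the instance. -/
def EnumProblem.HasPolyDelayAlgorithm (P : EnumProblem) : Prop :=
  ∃ (c : Prog) (p : Polynomial ℕ), ∀ (i : P.Inst) (f : ℕ → ℕ), P.IsCode i f →
    ∃ (tr : List Action) (s' : State), Exec c (State.init f) tr s' ∧
      ((outputs [] tr).map List.toFinset).Nodup ∧
      (∀ D : Finset ℕ, D ∈ (outputs [] tr).map List.toFinset ↔ D ∈ P.sol i) ∧
      ∀ t ∈ delays 0 tr, t ≤ p.eval (P.size i)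

/-- A set of elements of `{0, …, n - 1}` as a set of numbers. -/
def toNats {n : ℕ} (D : Finset (Fin n)) : Finset ℕ := D.map Fin.valEmbedding

/-! ### Minimal connected dominating sets in split graphs -/

/-- The vertex set is the union of a clique `C` and an independent set. -/
def IsSplit {V : Type*} (G : SimpleGraph V) : Prop :=
  ∃ C : Set V, G.IsClique C ∧ G.IsIndepSet Cᶜ

/-- Every vertex is in `D` or has a neighbour in `D`. -/
def IsDominating {V : Type*} (G : SimpleGraph V) (D : Finset V) : Prop :=
  ∀ v, v ∈ D ∨ ∃ u ∈ D, G.Adj u v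

/-- Connected dominating sets: `D` is dominating and induces a connected subgraph. -/
def IsCDS {V : Type*} (G : SimpleGraph V) (D : Finset V) : Prop :=
  IsDominating G D ∧ (G.induce (D : Set V)).Connected

open Classical in
/-- The array `f` holds the number of vertices, followed by the adjacency matrix, row by row. -/
def IsGraphCode {n : ℕ} (G : SimpleGraph (Fin n)) (f : ℕ → ℕ) : Prop :=
  f 0 = n ∧
  (∀ u v : Fin n, f (1 + (u * n + v)) = if G.Adj u v then 1 else 0) ∧
  ∀ k, 1 + n * n ≤ k → f k = 0

/-- Enumerate all inclusion-minimal connected dominating sets of a split graph with vertices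
`0, …, n - 1`. The size of an instance is its number `n` of vertices. -/
def minimalCDSInSplitGraphs : EnumProblem where
  Inst := Σ n : ℕ, {G : SimpleGraph (Fin n) // IsSplit G}
  size := fun i => i.1
  IsCode := fun i f => IsGraphCode i.2.1 f
  sol := fun i => {D | ∃ D' : Finset (Fin i.1), Minimal (IsCDS i.2.1) D' ∧ D = toNats D'}

/-! ### Minimal hitting sets in hypergraphs -/

/-- `H` meets every edge of the hypergraph with the edge set `E`. -/
def IsHittingSet {X : Type*} [DecidableEq X] (E : Finset (Finset X)) (H : Finset X) : Prop :=
  ∀ S ∈ E, (H ∩ S).Nonempty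

/-- The array `f` holds the number of vertices and the number of edges, followed by the
incidence matrix, one row per edge, the edges being listed in an arbitrary order `e`. -/
def IsHypergraphCode {n : ℕ} (E : Finset (Finset (Fin n))) (f : ℕ → ℕ) : Prop :=
  ∃ e : Fin E.card ≃ {S // S ∈ E},
    f 0 = n ∧ f 1 = E.card ∧
    (∀ (j : Fin E.card) (x : Fin n), f (2 + (j * n + x)) = if x ∈ (e j).1 then 1 else 0) ∧
    ∀ k, 2 + E.card * n ≤ k → f k = 0

/-- Enumerate all inclusion-minimal hitting sets of a hypergraph with vertices `0, …, n - 1` and an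
arbitrary set of edges. The size of an instance is its number of vertices plus its number of
edges. -/
def minimalHittingSets : EnumProblem where
  Inst := Σ n : ℕ, Finset (Finset (Fin n))
  size := fun i => i.1 + i.2.card
  IsCode := fun i f => IsHypergraphCode i.2 f
  sol := fun i => {D | ∃ H : Finset (Fin i.1), Minimal (IsHittingSet i.2) H ∧ D = toNats H}

end PolyDelay

/-!
A hypergraph on `X` is turned into a split graph whose clique is `X` and whose independent set
consists of the edges, each adjacent to its elements, and of one more vertex adjacent to all of
`X`. Since the independent set has at least two vertices, a set is a connected dominating set if
and only if every independent vertex has a neighbour in it, i.e. if and only if its trace on `X`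
is a nonempty hitting set. As soon as the hypergraph has an edge, the minimal connected dominating
sets are therefore, even as sets of numbers, the minimal hitting sets, so that a given enumeration
program can be run unchanged once the adjacency matrix has been written.
-/

namespace PolyDelay

section Minimal

theorem minimal_comp_iff_of_galoisCoinsertion {α β : Type*} [PartialOrder α] [PartialOrder β]
    {l : α → β} {u : β → α} (g : GaloisCoinsertion l u) (P : α → Prop) (b : β) :
    Minimal (fun b => P (u b)) b ↔ ∃ a, Minimal P a ∧ b = l a := by
  have hul := g.u_l_eq
  constructor
  · rintro ⟨hb, hmin⟩
    have hle : b ≤ l (u b) := hmin (by simpa only [hul] using hb) (g.gc.l_u_le b)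
    refine ⟨u b, ⟨hb, fun a ha hab => ?_⟩, hle.antisymm (g.gc.l_u_le b)⟩
    have hba : b ≤ l a := hmin (by simpa only [hul] using ha) (g.gc.l_le hab)
    exact (g.gc.monotone_u hba).trans_eq (hul a)
  · rintro ⟨a, ha, rfl⟩
    refine ⟨by simpa only [hul] using ha.1, fun b hb hle => g.gc.l_le (ha.2 hb ?_)⟩
    exact (g.gc.monotone_u hle).trans_eq (hul a)

variable {X V : Type*}

theorem minimal_preimage_iff (φ : X ↪ V) (P : Finset X → Prop) (D : Finset V) :
    Minimal (fun D => P (D.preimage φ φ.injective.injOn)) D ↔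
      ∃ H, Minimal P H ∧ D = H.map φ :=
  minimal_comp_iff_of_galoisCoinsertion (GaloisConnection.toGaloisCoinsertion
    (fun _ _ => Finset.map_subset_iff_subset_preimage)
    fun H x hx => by simpa using hx) P D

end Minimal

section SplitGraphs

variable {V : Type*} {G : SimpleGraph V} {C : Set V} {D : Finset V}

theorem exists_adj_of_connected_induce {D : Set V} (h : (G.induce D).Connected) {v w : V}
    (hv : v ∈ D) (hw : w ∈ D) (hvw : v ≠ w) : ∃ u ∈ D, G.Adj v u := by
  have : Nontrivial D := ⟨⟨v, hv⟩, ⟨w, hw⟩, fun h => hvw (congrArg Subtype.val h)⟩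
  obtain ⟨u, hu⟩ := h.preconnected.exists_adj_of_nontrivial ⟨v, hv⟩
  exact ⟨u, u.2, hu⟩

theorem IsCDS.exists_adj_of_notMem (hindep : G.IsIndepSet Cᶜ) (hC : Cᶜ.Nontrivial)
    (hD : IsCDS G D) {v : V} (hv : v ∉ C) : ∃ u ∈ D, G.Adj v u := by
  obtain ⟨hdom, hconn⟩ := hD
  rcases hdom v with hvD | ⟨u, hu, huv⟩
  · obtain ⟨w, hw, hwv⟩ := hC.exists_ne v
    obtain ⟨u, hu, hvu⟩ : ∃ u ∈ D, v ≠ u := by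
      rcases hdom w with hwD | ⟨u, hu, huw⟩
      · exact ⟨w, hwD, hwv.symm⟩
      · refine ⟨u, hu, ?_⟩
        rintro rfl
        exact hindep hv hw hwv.symm huw
    exact exists_adj_of_connected_induce hconn hvD hu hvu
  · exact ⟨u, hu, huv.symm⟩

theorem isCDS_iff_forall_notMem (hclique : G.IsClique C) (hindep : G.IsIndepSet Cᶜ)
    (hC : Cᶜ.Nontrivial) : IsCDS G D ↔ ∀ v ∉ C, ∃ u ∈ D, G.Adj v u := by
  refine ⟨fun hD v hv => hD.exists_adj_of_notMem hindep hC hv, fun h => ?_⟩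
  have h' : ∀ v ∉ C, ∃ u ∈ D, u ∈ C ∧ G.Adj v u := fun v hv => by
    obtain ⟨u, hu, hvu⟩ := h v hv
    exact ⟨u, hu, by_contra fun huC => hindep hv huC hvu.ne hvu, hvu⟩
  obtain ⟨v₀, hv₀⟩ := hC.nonempty
  obtain ⟨x, hx, hxC, -⟩ := h' v₀ hv₀
  have reach_of_mem : ∀ u (hu : u ∈ D), u ∈ C →
      (G.induce (D : Set V)).Reachable ⟨u, hu⟩ ⟨x, hx⟩ := fun u hu huC => by
    rcases eq_or_ne u x with rfl | hux
    · exact .refl _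
    · exact SimpleGraph.Adj.reachable (hclique huC hxC hux)
  have reach : ∀ v : (D : Set V), (G.induce (D : Set V)).Reachable v ⟨x, hx⟩ := by
    rintro ⟨v, hv⟩
    by_cases hvC : v ∈ C
    · exact reach_of_mem v hv hvC
    · obtain ⟨u, hu, huC, hvu⟩ := h' v hvC
      have huv : (G.induce (D : Set V)).Adj ⟨v, hv⟩ ⟨u, hu⟩ := hvu
      exact huv.reachable.trans (reach_of_mem u hu huC)
  refine ⟨fun v => ?_, ?_⟩
  · by_cases hvC : v ∈ C
    · rcases eq_or_ne v x with rfl | hvx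
      · exact .inl hx
      · exact .inr ⟨x, hx, hclique hxC hvC hvx.symm⟩
    · exact .inr ((h v hvC).imp fun u hu => ⟨hu.1, hu.2.symm⟩)
  · have : Nonempty (D : Set V) := ⟨⟨x, hx⟩⟩
    exact ⟨fun v w => (reach v).trans (reach w).symm⟩

variable {X : Type*} [DecidableEq X] {E : Finset (Finset X)} {φ : X ↪ V}

theorem minimal_isCDS_iff (hclique : G.IsClique (Set.range φ))
    (hindep : G.IsIndepSet (Set.range φ)ᶜ) (hφ : (Set.range φ)ᶜ.Nontrivial)
    (hadj : ∀ v ∉ Set.range φ, ∃ S ∈ E, ∀ x ∈ S, G.Adj v (φ x))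
    (hE : ∀ S ∈ E, ∃ v ∉ Set.range φ, ∀ x, G.Adj v (φ x) → x ∈ S) :
    Minimal (IsCDS G) D ↔ ∃ H, Minimal (IsHittingSet E) H ∧ D = H.map φ := by
  rw [← minimal_preimage_iff]
  suffices h : IsCDS G = fun D => IsHittingSet E (D.preimage φ φ.injective.injOn) by rw [h]
  ext D
  rw [isCDS_iff_forall_notMem hclique hindep hφ]
  constructor
  · intro h S hS
    obtain ⟨v, hv, hvS⟩ := hE S hS
    obtain ⟨u, hu, hvu⟩ := h v hv
    obtain ⟨x, rfl⟩ : u ∈ Set.range φ := by_contra fun hu => hindep hv hu hvu.ne hvu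
    exact ⟨x, Finset.mem_inter.2 ⟨Finset.mem_preimage.2 hu, hvS x hvu⟩⟩
  · intro h v hv
    obtain ⟨S, hS, hvS⟩ := hadj v hv
    obtain ⟨x, hx⟩ := h S hS
    rw [Finset.mem_inter, Finset.mem_preimage] at hx
    exact ⟨φ x, hx.1, hvS x hx.2⟩

end SplitGraphs

section SplitGraph

variable {n m : ℕ} (S : Fin m → Finset (Fin n))

/-- The split graph of a hypergraph with vertices `0, …, n - 1` and edges `S 0, …, S (m - 1)`. The
clique is `0, …, n - 1`, the vertex `n + j` stands for the edge `S j` and is adjacent to its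
elements, and the last vertex `n + m`, which matches no `j`, is adjacent to the whole clique. -/
def splitGraph : SimpleGraph (Fin (n + m + 1)) :=
  .fromRel fun u v => ∃ x : Fin n, u.1 = x ∧ ∀ j : Fin m, v.1 = n + j → x ∈ S j

/-- The vertices of the hypergraph as vertices of its `splitGraph`. -/
def vertexEmb (n m : ℕ) : Fin n ↪ Fin (n + m + 1) := Fin.castLEEmb (by omega)

theorem mem_range_vertexEmb {v : Fin (n + m + 1)} : v ∈ Set.range (vertexEmb n m) ↔ v.1 < n := by
  simp [vertexEmb, Fin.range_castLE]

theorem adj_splitGraph_of_lt {u v : Fin (n + m + 1)} (hu : u.1 < n) (hv : v.1 < n) :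
    (splitGraph S).Adj u v ↔ u ≠ v := by
  rw [splitGraph, SimpleGraph.fromRel_adj, and_iff_left_iff_imp]
  exact fun _ => .inl ⟨⟨u, hu⟩, rfl, fun j hj => by omega⟩

theorem adj_splitGraph_of_le {u v : Fin (n + m + 1)} (hu : n ≤ u.1) :
    (splitGraph S).Adj u v ↔
      ∃ x : Fin n, v.1 = x ∧ ∀ j : Fin m, u.1 = n + j → x ∈ S j := by
  rw [splitGraph, SimpleGraph.fromRel_adj]
  constructor
  · rintro ⟨-, ⟨x, hx, -⟩ | h⟩
    · omega
    · exact h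
  · rintro ⟨x, hx, h⟩
    exact ⟨fun huv => by omega, .inr ⟨x, hx, h⟩⟩

theorem isClique_splitGraph : (splitGraph S).IsClique (Set.range (vertexEmb n m)) :=
  fun _ hu _ hv => (adj_splitGraph_of_lt S (mem_range_vertexEmb.1 hu) (mem_range_vertexEmb.1 hv)).2

theorem isIndepSet_splitGraph : (splitGraph S).IsIndepSet (Set.range (vertexEmb n m))ᶜ := by
  intro u hu v hv _ h
  rw [Set.mem_compl_iff, mem_range_vertexEmb] at hu hv
  obtain ⟨x, hx, -⟩ := (adj_splitGraph_of_le S (by omega)).1 h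
  omega

theorem isSplit_splitGraph : IsSplit (splitGraph S) :=
  ⟨_, isClique_splitGraph S, isIndepSet_splitGraph S⟩

theorem minimal_isCDS_splitGraph_iff {E : Finset (Finset (Fin n))} (hE : E.Nonempty)
    (hS : Set.range S = E) (D : Finset (Fin (n + m + 1))) :
    Minimal (IsCDS (splitGraph S)) D ↔
      ∃ H, Minimal (IsHittingSet E) H ∧ D = H.map (vertexEmb n m) := by
  have hS' : ∀ F, F ∈ E ↔ ∃ j, S j = F := fun F => (Set.ext_iff.1 hS F).symm
  obtain ⟨j₀, -⟩ := (hS' _).1 hE.choose_spec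
  refine minimal_isCDS_iff (isClique_splitGraph S) (isIndepSet_splitGraph S) ?_ ?_ ?_
  · refine ⟨⟨n, by omega⟩, ?_, Fin.last (n + m), ?_, ?_⟩
    · simp only [Set.mem_compl_iff, mem_range_vertexEmb, lt_irrefl, not_false_iff]
    · simp only [Set.mem_compl_iff, mem_range_vertexEmb, Fin.val_last, not_lt, Nat.le_add_right]
    · simpa only [ne_eq, Fin.ext_iff, Fin.val_last, left_eq_add] using j₀.pos.ne'
  · intro v hv
    rw [mem_range_vertexEmb] at hv
    obtain ⟨j, hj⟩ : ∃ j : Fin m, ∀ j' : Fin m, v.1 = n + j' → j' = j := by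
      by_cases h : v.1 < n + m
      · exact ⟨⟨v - n, by omega⟩, fun j' hj' => Fin.ext (show j'.1 = v - n by omega)⟩
      · exact ⟨j₀, fun j' hj' => by omega⟩
    refine ⟨S j, (hS' _).2 ⟨j, rfl⟩, fun x hx => ?_⟩
    exact (adj_splitGraph_of_le S (by omega)).2 ⟨x, rfl, fun j' hj' => hj j' hj' ▸ hx⟩
  · intro F hF
    obtain ⟨j, rfl⟩ := (hS' F).1 hF
    refine ⟨⟨n + j, by omega⟩, by rw [mem_range_vertexEmb]; simp, fun x h => ?_⟩
    obtain ⟨y, hy, hyS⟩ := (adj_splitGraph_of_le S (by simp)).1 h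
    rw [show x = y from Fin.ext hy]
    exact hyS j rfl

end SplitGraph

section Runs

theorem logCost_le (v : ℕ) : logCost v ≤ v + 1 :=
  Nat.succ_le_succ (Nat.size_le.2 Nat.lt_two_pow_self)

theorem outputs_ticks_append (ts : List ℕ) (cur : List ℕ) (tr : List Action) :
    outputs cur (ts.map .tick ++ tr) = outputs cur tr := by
  induction ts with
  | nil => rfl
  | cons _ _ ih => exact ih

theorem delays_ticks_append (ts : List ℕ) (a : ℕ) (tr : List Action) :
    delays a (ts.map .tick ++ tr) = delays (a + ts.sum) tr := by
  induction ts generalizing a with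
  | nil => rfl
  | cons t ts ih => rw [List.sum_cons, ← add_assoc]; exact ih (a + t)

theorem delays_add_le {a T : ℕ} {tr : List Action} (h : ∀ t ∈ delays a tr, t ≤ T) (k : ℕ) :
    ∀ t ∈ delays (a + k) tr, t ≤ T + k := by
  induction tr generalizing a with
  | nil => simpa only [delays, List.mem_singleton, forall_eq, add_le_add_iff_right] using h
  | cons x tr ih =>
    cases x with
    | tick l => simpa only [delays, add_right_comm] using ih h
    | put v => exact ih h
    | emit =>
      rw [delays, List.forall_mem_cons] at h ⊢
      exact ⟨Nat.add_le_add_right h.1 k, fun t ht => (h.2 t ht).trans (Nat.le_add_right T k)⟩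

/-- The program `c`, started in memory `s`, halts in memory `s'` after time at most `T` without
touching the output. -/
def Runs (c : Prog) (s : State) (T : ℕ) (s' : State) : Prop :=
  ∃ ts : List ℕ, Exec c s (ts.map .tick) s' ∧ ts.sum ≤ T

variable {c d : Prog} {s s' s'' : State} {t x T T' : ℕ}

theorem Exec.runs (h : Exec c s [.tick t] s') (ht : t ≤ T) : Runs c s T s' :=
  ⟨[t], h, by simpa using ht⟩

theorem Runs.mono (h : Runs c s T s') (hT : T ≤ T') : Runs c s T' s' :=
  h.imp fun _ h => ⟨h.1, h.2.trans hT⟩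

theorem Runs.seq (h : Runs c s T s') (h' : Runs d s' T' s'') :
    Runs (.seq c d) s (T + T') s'' := by
  obtain ⟨ts, hts, hT⟩ := h
  obtain ⟨ts', hts', hT'⟩ := h'
  refine ⟨ts ++ ts', ?_, by simpa using Nat.add_le_add hT hT'⟩
  rw [List.map_append]
  exact hts.seq hts'

theorem Runs.ite_true (hx : s.reg x ≠ 0) (h : Runs c s T s') :
    Runs (.ite x c d) s (logCost (s.reg x) + T) s' := by
  obtain ⟨ts, hts, hT⟩ := h
  exact ⟨_ :: ts, .ite_true hx hts, by simpa using hT⟩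

theorem Runs.ite_false (hx : s.reg x = 0) (h : Runs d s T s') :
    Runs (.ite x c d) s (logCost (s.reg x) + T) s' := by
  obtain ⟨ts, hts, hT⟩ := h
  exact ⟨_ :: ts, .ite_false hx hts, by simpa using hT⟩

theorem Runs.loop_true (hx : s.reg x ≠ 0) (h : Runs c s T s') (h' : Runs (.loop x c) s' T' s'') :
    Runs (.loop x c) s (logCost (s.reg x) + (T + T')) s'' := by
  obtain ⟨ts, hts, hT⟩ := h
  obtain ⟨ts', hts', hT'⟩ := h'
  refine ⟨logCost (s.reg x) :: (ts ++ ts'), ?_, by simpa using Nat.add_le_add hT hT'⟩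
  rw [List.map_cons, List.map_append]
  exact .loop_true hx hts hts'

theorem Runs.countdown {S : ℕ → State} {L : ℕ} (hreg : ∀ k, (S k).reg x = k)
    (hstep : ∀ k < L, Runs c (S (k + 1)) T (S k)) :
    Runs (.loop x c) (S L) ((L + 1) * (T + L + 1)) (S 0) := by
  suffices h : ∀ k ≤ L, Runs (.loop x c) (S k) (k * (T + L + 1) + 1) (S 0) from
    (h L le_rfl).mono (by rw [Nat.succ_mul]; omega)
  intro k hk
  induction k with
  | zero =>
    have hcost := logCost_le 0
    exact (Exec.loop_false (hreg 0)).runs (by rw [hreg]; omega)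
  | succ k ih =>
    have hx : (S (k + 1)).reg x = k + 1 := hreg (k + 1)
    refine (Runs.loop_true (by omega) (hstep k hk) (ih (by omega))).mono ?_
    have := logCost_le (k + 1)
    rw [hx, Nat.succ_mul]
    omega

end Runs

section Enumerates

/-- The program `c`, started in memory `s`, outputs every set in `Sol` exactly once and nothing
else, and halts, with all delays at most `T`. -/
def Enumerates (c : Prog) (s : State) (Sol : Set (Finset ℕ)) (T : ℕ) : Prop :=
  ∃ (tr : List Action) (s' : State), Exec c s tr s' ∧
    ((outputs [] tr).map List.toFinset).Nodup ∧
    (∀ D : Finset ℕ, D ∈ (outputs [] tr).map List.toFinset ↔ D ∈ Sol) ∧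
    ∀ t ∈ delays 0 tr, t ≤ T

variable {c d : Prog} {s s' : State} {x T T' : ℕ} {Sol : Set (Finset ℕ)}

theorem enumerates_emit (s : State) : Enumerates .emit s {∅} 1 :=
  ⟨_, s, .emit s, by simp [outputs], by simp [outputs], by simp [delays]⟩

theorem Enumerates.mono (h : Enumerates c s Sol T) (hT : T ≤ T') : Enumerates c s Sol T' := by
  obtain ⟨tr, s', hexec, hnodup, hmem, hdelay⟩ := h
  exact ⟨tr, s', hexec, hnodup, hmem, fun t ht => (hdelay t ht).trans hT⟩

theorem Enumerates.of_ticks_append {ts : List ℕ} (hts : ts.sum ≤ T)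
    (hcd : ∀ tr s'', Exec d s' tr s'' → Exec c s (ts.map .tick ++ tr) s'')
    (h : Enumerates d s' Sol T') : Enumerates c s Sol (T + T') := by
  obtain ⟨tr, s'', hexec, hnodup, hmem, hdelay⟩ := h
  refine ⟨_, s'', hcd tr s'' hexec, ?_⟩
  rw [outputs_ticks_append, delays_ticks_append]
  refine ⟨hnodup, hmem, fun t ht => (delays_add_le hdelay _ t ht).trans ?_⟩
  omega

theorem Runs.seq_enumerates (h : Runs c s T s') (h' : Enumerates d s' Sol T') :
    Enumerates (.seq c d) s Sol (T + T') := by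
  obtain ⟨ts, hts, hT⟩ := h
  exact h'.of_ticks_append hT fun _ _ => hts.seq

theorem Enumerates.ite_true (hx : s.reg x ≠ 0) (h : Enumerates c s Sol T) :
    Enumerates (.ite x c d) s Sol (logCost (s.reg x) + T) :=
  h.of_ticks_append (ts := [_]) (by simp) fun _ _ => .ite_true hx

theorem Enumerates.ite_false (hx : s.reg x = 0) (h : Enumerates d s Sol T) :
    Enumerates (.ite x c d) s Sol (logCost (s.reg x) + T) :=
  h.of_ticks_append (ts := [_]) (by simp) fun _ _ => .ite_false hx

end Enumerates

section Rename

/-- Replace every register `x` of a program by `ρ x` and every array `a` by `α a`. -/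
def Prog.rename (ρ α : ℕ → ℕ) : Prog → Prog
  | .skip => .skip
  | .const x k => .const (ρ x) k
  | .add x y z => .add (ρ x) (ρ y) (ρ z)
  | .sub x y z => .sub (ρ x) (ρ y) (ρ z)
  | .mul x y z => .mul (ρ x) (ρ y) (ρ z)
  | .load x a y => .load (ρ x) (α a) (ρ y)
  | .store a y x => .store (α a) (ρ y) (ρ x)
  | .put x => .put (ρ x)
  | .emit => .emit
  | .seq c d => .seq (c.rename ρ α) (d.rename ρ α)
  | .ite x c d => .ite (ρ x) (c.rename ρ α) (d.rename ρ α)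
  | .loop x c => .loop (ρ x) (c.rename ρ α)

/-- The part of the memory that a program renamed by `ρ` and `α` can access, as the original
program sees it. -/
def State.comap (ρ α : ℕ → ℕ) (s : State) : State where
  reg := s.reg ∘ ρ
  mem := s.mem ∘ α

variable {ρ α : ℕ → ℕ}

theorem State.comap_setReg (hρ : ρ.Injective) (s : State) (x v : ℕ) :
    (s.setReg (ρ x) v).comap ρ α = (s.comap ρ α).setReg x v := by
  simp only [State.comap, State.setReg, Function.update_comp_eq_of_injective _ hρ]

theorem State.comap_setMem (hα : α.Injective) (s : State) (a i v : ℕ) :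
    (s.setMem (α a) i v).comap ρ α = (s.comap ρ α).setMem a i v := by
  simp only [State.comap, State.setMem, Function.update_comp_eq_of_injective _ hα,
    Function.comp_apply]

theorem Exec.rename (hρ : ρ.Injective) (hα : α.Injective) {c : Prog} {s s₁ : State}
    {tr : List Action} (h : Exec c s tr s₁) : ∀ s', s'.comap ρ α = s →
    ∃ s₁', Exec (c.rename ρ α) s' tr s₁' ∧ s₁'.comap ρ α = s₁ := by
  induction h with
  | skip => exact fun s' hs => ⟨s', .skip s', hs⟩
  | const _ x k => rintro s' rfl; exact ⟨_, .const s' (ρ x) k, s'.comap_setReg hρ x _⟩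
  | add _ x y z => rintro s' rfl; exact ⟨_, .add s' (ρ x) (ρ y) (ρ z), s'.comap_setReg hρ x _⟩
  | sub _ x y z => rintro s' rfl; exact ⟨_, .sub s' (ρ x) (ρ y) (ρ z), s'.comap_setReg hρ x _⟩
  | mul _ x y z => rintro s' rfl; exact ⟨_, .mul s' (ρ x) (ρ y) (ρ z), s'.comap_setReg hρ x _⟩
  | load _ x a y => rintro s' rfl; exact ⟨_, .load s' (ρ x) (α a) (ρ y), s'.comap_setReg hρ x _⟩
  | store _ a y x => rintro s' rfl; exact ⟨_, .store s' (α a) (ρ y) (ρ x), s'.comap_setMem hα a _ _⟩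
  | put _ x => rintro s' rfl; exact ⟨s', .put s' (ρ x), rfl⟩
  | emit => exact fun s' hs => ⟨s', .emit s', hs⟩
  | seq _ _ ihc ihd =>
    intro s' hs
    obtain ⟨s₁, hc, hs₁⟩ := ihc s' hs
    obtain ⟨s₂, hd, hs₂⟩ := ihd s₁ hs₁
    exact ⟨s₂, hc.seq hd, hs₂⟩
  | ite_true hx _ ih =>
    rintro s' rfl
    obtain ⟨s₁, hc, hs₁⟩ := ih s' rfl
    exact ⟨s₁, .ite_true (x := ρ _) hx hc, hs₁⟩
  | ite_false hx _ ih =>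
    rintro s' rfl
    obtain ⟨s₁, hc, hs₁⟩ := ih s' rfl
    exact ⟨s₁, .ite_false (x := ρ _) hx hc, hs₁⟩
  | loop_true hx _ _ ihc ihl =>
    rintro s' rfl
    obtain ⟨s₁, hc, hs₁⟩ := ihc s' rfl
    obtain ⟨s₂, hl, hs₂⟩ := ihl s₁ hs₁
    exact ⟨s₂, .loop_true (x := ρ _) hx hc hl, hs₂⟩
  | loop_false hx => rintro s' rfl; exact ⟨s', .loop_false (x := ρ _) hx, rfl⟩

theorem Enumerates.rename (hρ : ρ.Injective) (hα : α.Injective) {c : Prog} {s : State}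
    {Sol : Set (Finset ℕ)} {T : ℕ} (h : Enumerates c (s.comap ρ α) Sol T) :
    Enumerates (c.rename ρ α) s Sol T := by
  obtain ⟨tr, _, hexec, hout⟩ := h
  obtain ⟨s', hexec', -⟩ := hexec.rename hρ hα s rfl
  exact ⟨tr, s', hexec', hout⟩

end Rename

section States

theorem State.ext {s s' : State} (hreg : ∀ x, s.reg x = s'.reg x)
    (hmem : ∀ a i, s.mem a i = s'.mem a i) : s = s' := by
  cases s
  cases s'
  congr
  · exact funext hreg
  · exact funext fun a => funext (hmem a)

variable (s : State) (x v w a i : ℕ)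

theorem State.reg_setReg_self : (s.setReg x v).reg x = v := Function.update_self ..

theorem State.reg_setReg_of_ne {x y : ℕ} (h : y ≠ x) : (s.setReg x v).reg y = s.reg y :=
  Function.update_of_ne h ..

theorem State.setReg_setReg : (s.setReg x v).setReg x w = s.setReg x w := by
  simp only [State.setReg, Function.update_idem]

theorem State.setReg_comm {x y : ℕ} (h : x ≠ y) :
    (s.setReg x v).setReg y w = (s.setReg y w).setReg x v := by
  simp only [State.setReg, Function.update_comm h]

theorem State.setReg_eq_self {s : State} {x v : ℕ} (h : s.reg x = v) : s.setReg x v = s := by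
  subst h
  simp only [State.setReg, Function.update_eq_self]

theorem State.setReg_setMem : (s.setReg x v).setMem a i w = (s.setMem a i w).setReg x v := rfl

/-- The registers from `r` on are zero. -/
def State.ClearFrom (s : State) (r : ℕ) : Prop := ∀ x, r ≤ x → s.reg x = 0

/-- All numbers in the memory are at most `M`. -/
def State.Bounded (s : State) (M : ℕ) : Prop := (∀ x, s.reg x ≤ M) ∧ ∀ a i, s.mem a i ≤ M

variable {s x v} {r M M' : ℕ}

theorem State.ClearFrom.mono {r' : ℕ} (h : s.ClearFrom r) (hr : r ≤ r') : s.ClearFrom r' :=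
  fun x hx => h x (hr.trans hx)

theorem State.ClearFrom.setReg (h : s.ClearFrom r) (hx : x < r) (v : ℕ) :
    (s.setReg x v).ClearFrom r :=
  fun y hy => (s.reg_setReg_of_ne v (by omega)).trans (h y hy)

theorem State.Bounded.mono (h : s.Bounded M) (hM : M ≤ M') : s.Bounded M' :=
  ⟨fun x => (h.1 x).trans hM, fun a i => (h.2 a i).trans hM⟩

theorem State.Bounded.setReg (h : s.Bounded M) (x : ℕ) (hv : v ≤ M) :
    (s.setReg x v).Bounded M :=
  ⟨(Function.forall_update_iff s.reg fun _ w => w ≤ M).2 ⟨hv, fun y _ => h.1 y⟩, h.2⟩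

theorem State.Bounded.setMem (h : s.Bounded M) (a i : ℕ) (hv : v ≤ M) :
    (s.setMem a i v).Bounded M :=
  ⟨h.1, (Function.forall_update_iff s.mem fun _ g => ∀ j, g j ≤ M).2
    ⟨(Function.forall_update_iff (s.mem a) fun _ w => w ≤ M).2 ⟨hv, fun j _ => h.2 a j⟩,
      fun b _ => h.2 b⟩⟩

end States

section Expressions

/-- The arithmetic operations of the machine. -/
inductive BinOp : Type
  | add
  | sub
  | mul

/-- The function that an operation computes. -/
def BinOp.eval : BinOp → ℕ → ℕ → ℕ
  | .add => (· + ·)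
  | .sub => (· - ·)
  | .mul => (· * ·)

/-- The instruction that applies an operation to two registers. -/
def BinOp.instr : BinOp → ℕ → ℕ → ℕ → Prog
  | .add => .add
  | .sub => .sub
  | .mul => .mul

/-- Arithmetic expressions in the registers `0, …, r - 1` and in the arrays. -/
inductive Expr (r : ℕ) : Type
  | const (k : ℕ)
  | reg (x : Fin r)
  | bin (o : BinOp) (e e' : Expr r)
  | get (a : ℕ) (e : Expr r)
  | cond (c e e' : Expr r)

namespace Expr

variable {r : ℕ}

instance (k : ℕ) : OfNat (Expr r) k := ⟨const k⟩
instance : Add (Expr r) := ⟨bin .add⟩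
instance : Sub (Expr r) := ⟨bin .sub⟩
instance : Mul (Expr r) := ⟨bin .mul⟩

/-- The value of an expression in a memory. -/
def eval (s : State) : Expr r → ℕ
  | const k => k
  | reg x => s.reg x
  | bin o e e' => o.eval (e.eval s) (e'.eval s)
  | get a e => s.mem a (e.eval s)
  | cond c e e' => if c.eval s ≠ 0 then e.eval s else e'.eval s

theorem eval_sub (s : State) (e e' : Expr r) : (e - e').eval s = e.eval s - e'.eval s := rfl

theorem eval_cond_sub (s : State) (a b e e' : Expr r) :
    (cond (a - b) e e').eval s = if b.eval s < a.eval s then e.eval s else e'.eval s :=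
  if_congr Nat.sub_ne_zero_iff_lt rfl rfl

theorem eval_cond_sub_add_sub (s : State) (a b e e' : Expr r) :
    (cond ((a - b) + (b - a)) e e').eval s = if a.eval s = b.eval s then e'.eval s else e.eval s :=
  (if_congr (by simp only [eval, BinOp.eval, eval_sub]; omega) rfl rfl).trans (ite_not ..)

/-- The program that writes the value of an expression to the register `d`. For `r ≤ d`, it uses the
registers above `d` as a stack, which it expects to be cleared and leaves cleared. -/
def compile : Expr r → ℕ → Prog
  | const k, d => .const d k
  | reg x, d => .add d x (d + 1)
  | bin o e e', d =>
      .seq (e.compile d) (.seq (e'.compile (d + 1)) (.seq (o.instr d d (d + 1)) (.const (d + 1) 0)))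
  | get a e, d => .seq (e.compile d) (.load d a d)
  | cond c e e', d => .seq (c.compile d) (.ite d (e.compile d) (e'.compile d))

theorem eval_setReg_of_le (e : Expr r) (s : State) {d : ℕ} (hd : r ≤ d) (v : ℕ) :
    e.eval (s.setReg d v) = e.eval s := by
  induction e with
  | const k => rfl
  | reg x => exact s.reg_setReg_of_ne v (by omega)
  | bin o e e' ih ih' => rw [eval, ih, ih', eval]
  | get a e ih => rw [eval, ih]; rfl
  | cond c e e' ihc ih ih' => rw [eval, ihc, ih, ih', eval]

/-- The compiled expression is evaluated correctly, and both its value and the running time are at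
most `q M` in a memory with numbers up to `M`. -/
def RunsWithin (e : Expr r) (q : Polynomial ℕ) : Prop :=
  ∀ ⦃s : State⦄ ⦃d M : ℕ⦄, r ≤ d → s.ClearFrom (d + 1) → s.Bounded M →
    e.eval s ≤ q.eval M ∧ Runs (e.compile d) s (q.eval M) (s.setReg d (e.eval s))

end Expr

theorem BinOp.eval_le (o : BinOp) {v w A B : ℕ} (hv : v ≤ A) (hw : w ≤ B) :
    o.eval v w ≤ A + B + A * B := by
  have := Nat.mul_le_mul hv hw
  cases o <;> simp only [BinOp.eval] <;> omega

theorem BinOp.runs_instr (o : BinOp) (s : State) (x y z : ℕ) {A B : ℕ} (hy : s.reg y ≤ A)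
    (hz : s.reg z ≤ B) :
    Runs (o.instr x y z) s (A + B + 2) (s.setReg x (o.eval (s.reg y) (s.reg z))) := by
  have := logCost_le (s.reg y)
  have := logCost_le (s.reg z)
  have ht : logCost (s.reg y) + logCost (s.reg z) ≤ A + B + 2 := by omega
  cases o with
  | add => exact (Exec.add s x y z).runs ht
  | sub => exact (Exec.sub s x y z).runs ht
  | mul => exact (Exec.mul s x y z).runs ht

theorem runs_clear (s : State) (x : ℕ) : Runs (.const x 0) s 1 (s.setReg x 0) :=
  (Exec.const s x 0).runs (logCost_le 0)

namespace Expr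

variable {r : ℕ} {e e' c : Expr r} {q q' q'' : Polynomial ℕ}

theorem runsWithin_const (k : ℕ) : (const k : Expr r).RunsWithin (k + 1) := by
  intro s d M _ _ _
  have hk : ((k + 1 : Polynomial ℕ)).eval M = k + 1 := by simp
  rw [hk]
  exact ⟨Nat.le_succ k, (Exec.const s d k).runs (logCost_le k)⟩

theorem runsWithin_reg (x : Fin r) : (reg x).RunsWithin (.X + 2) := by
  intro s d M _ hclear hs
  have hM : (.X + 2 : Polynomial ℕ).eval M = M + 2 := by simp
  have h0 : s.reg (d + 1) = 0 := hclear _ le_rfl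
  have hrun := BinOp.add.runs_instr s d x (d + 1) (hs.1 x) h0.le
  rw [h0] at hrun
  rw [hM]
  exact ⟨(hs.1 x).trans (Nat.le_add_right M 2), hrun⟩

theorem RunsWithin.of_setReg (h' : e'.RunsWithin q') {s : State} {x d v M : ℕ} (hx : r ≤ x)
    (hxd : x ≤ d) (hclear : s.ClearFrom (d + 1)) (hs : s.Bounded M) (hv : v ≤ q.eval M) :
    e'.eval s ≤ (q'.comp (q + .X)).eval M ∧
      Runs (e'.compile d) (s.setReg x v) ((q'.comp (q + .X)).eval M)
        ((s.setReg x v).setReg d (e'.eval s)) := by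
  rw [Polynomial.eval_comp, ← e'.eval_setReg_of_le s hx v]
  exact h' (hx.trans hxd) (hclear.setReg (Nat.lt_succ_of_le hxd) v)
    ((hs.mono (by simp)).setReg x (hv.trans (by simp)))

theorem RunsWithin.bin (o : BinOp) (h : e.RunsWithin q) (h' : e'.RunsWithin q') :
    (e.bin o e').RunsWithin
      (2 * (q + q'.comp (q + .X)) + q * q'.comp (q + .X) + 3) := by
  intro s d M hd hclear hs
  obtain ⟨hv, hrun⟩ := h hd hclear hs
  obtain ⟨hv', hrun'⟩ := h'.of_setReg hd (Nat.le_succ d) (hclear.mono (Nat.le_succ _)) hs hv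
  set v := e.eval s
  set w := e'.eval s
  set s' := (s.setReg d v).setReg (d + 1) w
  have hne : d ≠ d + 1 := (Nat.lt_succ_self d).ne
  have hd' : s'.reg d = v := by rw [State.reg_setReg_of_ne _ _ hne, State.reg_setReg_self]
  have hd1 : s'.reg (d + 1) = w := State.reg_setReg_self ..
  have hinstr := o.runs_instr s' d d (d + 1) (hd'.trans_le hv) (hd1.trans_le hv')
  have hfinal : (s'.setReg d (o.eval v w)).setReg (d + 1) 0 = s.setReg d (o.eval v w) := by
    rw [State.setReg_comm _ _ _ hne.symm, State.setReg_setReg, State.setReg_setReg]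
    exact State.setReg_eq_self ((s.reg_setReg_of_ne _ hne.symm).trans (hclear _ le_rfl))
  rw [hd', hd1] at hinstr
  have hrun_bin := hrun.seq (hrun'.seq (hinstr.seq (runs_clear _ (d + 1))))
  rw [hfinal] at hrun_bin
  simp only [Polynomial.eval_add, Polynomial.eval_mul, Polynomial.eval_ofNat]
  exact ⟨(o.eval_le hv hv').trans (by omega), hrun_bin.mono (by omega)⟩

theorem RunsWithin.get (a : ℕ) (h : e.RunsWithin q) : (e.get a).RunsWithin (2 * q + .X + 2) := by
  intro s d M hd hclear hs
  obtain ⟨hv, hrun⟩ := h hd hclear hs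
  have hload := Exec.load (s.setReg d (e.eval s)) d a d
  rw [State.reg_setReg_self, State.setReg_setReg] at hload
  have hcell : s.mem a (e.eval s) ≤ M := hs.2 a _
  simp only [Polynomial.eval_add, Polynomial.eval_mul, Polynomial.eval_ofNat, Polynomial.eval_X]
  refine ⟨hcell.trans (by omega), (hrun.seq (hload.runs le_rfl)).mono ?_⟩
  have := logCost_le (e.eval s)
  have : logCost ((s.setReg d (e.eval s)).mem a (e.eval s)) ≤ M + 1 :=
    (logCost_le _).trans (Nat.succ_le_succ hcell)
  omega

theorem RunsWithin.cond (hc : c.RunsWithin q) (h : e.RunsWithin q') (h' : e'.RunsWithin q'') :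
    (c.cond e e').RunsWithin (2 * q + q'.comp (q + .X) + q''.comp (q + .X) + 1) := by
  intro s d M hd hclear hs
  obtain ⟨hv, hrun⟩ := hc hd hclear hs
  obtain ⟨hw, hrun'⟩ := h.of_setReg hd le_rfl hclear hs hv
  obtain ⟨hw', hrun''⟩ := h'.of_setReg hd le_rfl hclear hs hv
  rw [State.setReg_setReg] at hrun' hrun''
  have hcost := (logCost_le (c.eval s)).trans (Nat.succ_le_succ hv)
  simp only [Polynomial.eval_add, Polynomial.eval_mul, Polynomial.eval_ofNat, Polynomial.eval_one]
  have hreg := s.reg_setReg_self d (c.eval s)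
  by_cases hx : c.eval s = 0
  · rw [eval, if_neg (not_not.2 hx)]
    refine ⟨by omega, (hrun.seq (.ite_false (hreg.trans hx) hrun'')).mono ?_⟩
    rw [hreg]
    omega
  · rw [eval, if_pos hx]
    refine ⟨by omega, (hrun.seq (.ite_true (hreg.trans_ne hx) hrun')).mono ?_⟩
    rw [hreg]
    omega

theorem exists_runsWithin (e : Expr r) : ∃ q, e.RunsWithin q := by
  induction e with
  | const k => exact ⟨_, runsWithin_const k⟩
  | reg x => exact ⟨_, runsWithin_reg x⟩
  | bin o _ _ ih ih' => exact ⟨_, ih.choose_spec.bin o ih'.choose_spec⟩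
  | get a _ ih => exact ⟨_, ih.choose_spec.get a⟩
  | cond _ _ _ ihc ih ih' => exact ⟨_, ihc.choose_spec.cond ih.choose_spec ih'.choose_spec⟩

end Expr
end Expressions

section PolyTime

/-- In memories whose registers from `r` on are zero, the program `c` computes the memory
transformation `F` and keeps these registers zero; the running time and the numbers in the final
memory are bounded by a polynomial in the largest number in the initial memory. -/
def PolyTime (r : ℕ) (c : Prog) (F : State → State) : Prop :=
  ∃ q : Polynomial ℕ, ∀ ⦃s : State⦄ ⦃M : ℕ⦄, s.ClearFrom r → s.Bounded M →
    (F s).ClearFrom r ∧ (F s).Bounded (q.eval M) ∧ Runs c s (q.eval M) (F s)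

theorem PolyTime.seq {r : ℕ} {c d : Prog} {F G : State → State} (hc : PolyTime r c F)
    (hd : PolyTime r d G) : PolyTime r (.seq c d) (G ∘ F) := by
  obtain ⟨q, hq⟩ := hc
  obtain ⟨q', hq'⟩ := hd
  refine ⟨q + q'.comp q, fun s M hclear hs => ?_⟩
  obtain ⟨hclear', hs', hrun⟩ := hq hclear hs
  obtain ⟨hclear'', hs'', hrun'⟩ := hq' hclear' hs'
  rw [Polynomial.eval_add, Polynomial.eval_comp]
  exact ⟨hclear'', hs''.mono (Nat.le_add_left ..), hrun.seq hrun'⟩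

variable {r : ℕ}

/-- `x := e` -/
def Prog.assign (x : Fin r) (e : Expr r) : Prog :=
  .seq (e.compile r) (.seq (.add x r (r + 1)) (.const r 0))

/-- `a[i] := e` -/
def Prog.assignCell (a : ℕ) (i e : Expr r) : Prog :=
  .seq (i.compile r) (.seq (e.compile (r + 1))
    (.seq (.store a r (r + 1)) (.seq (.const r 0) (.const (r + 1) 0))))

theorem polyTime_assign (x : Fin r) (e : Expr r) :
    PolyTime r (.assign x e) fun s => s.setReg x (e.eval s) := by
  obtain ⟨q, hq⟩ := e.exists_runsWithin
  refine ⟨2 * q + .X + 3, fun s M hclear hs => ?_⟩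
  obtain ⟨hv, hrun⟩ := hq le_rfl (hclear.mono (Nat.le_succ r)) hs
  simp only [Polynomial.eval_add, Polynomial.eval_mul, Polynomial.eval_ofNat, Polynomial.eval_X]
  refine ⟨hclear.setReg x.2 _, (hs.mono (by omega)).setReg x (by omega), ?_⟩
  set v := e.eval s
  have hr : (s.setReg r v).reg r = v := s.reg_setReg_self r v
  have hr1 : (s.setReg r v).reg (r + 1) = 0 :=
    (s.reg_setReg_of_ne v (Nat.succ_ne_self r)).trans (hclear _ (Nat.le_succ r))
  have hadd := BinOp.add.runs_instr (s.setReg r v) x r (r + 1) (hr.trans_le hv) hr1.le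
  have hfinal : ((s.setReg r v).setReg x v).setReg r 0 = s.setReg x v := by
    rw [State.setReg_comm _ _ _ x.2.ne', State.setReg_setReg, State.setReg_comm _ _ _ x.2.ne,
      State.setReg_eq_self (hclear r le_rfl)]
  rw [hr, hr1] at hadd
  have hrun_assign := hrun.seq (hadd.seq (runs_clear _ r))
  rw [show BinOp.add.eval v 0 = v from rfl, hfinal] at hrun_assign
  exact hrun_assign.mono (by omega)

theorem polyTime_assignCell (a : ℕ) (i e : Expr r) :
    PolyTime r (.assignCell a i e) fun s => s.setMem a (i.eval s) (e.eval s) := by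
  obtain ⟨q, hq⟩ := i.exists_runsWithin
  obtain ⟨q', hq'⟩ := e.exists_runsWithin
  refine ⟨2 * q + 2 * q'.comp (q + .X) + .X + 4, fun s M hclear hs => ?_⟩
  obtain ⟨hv, hrun⟩ := hq le_rfl (hclear.mono (Nat.le_succ r)) hs
  obtain ⟨hw, hrun'⟩ := hq'.of_setReg le_rfl (Nat.le_succ r)
    (hclear.mono (Nat.le_add_right r 2)) hs hv
  simp only [Polynomial.eval_add, Polynomial.eval_mul, Polynomial.eval_ofNat, Polynomial.eval_X]
  refine ⟨hclear, (hs.mono (by omega)).setMem a _ (by omega), ?_⟩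
  set v := i.eval s
  set w := e.eval s
  set s' := (s.setReg r v).setReg (r + 1) w
  have hne : r ≠ r + 1 := (Nat.lt_succ_self r).ne
  have hr : s'.reg r = v := by rw [State.reg_setReg_of_ne _ _ hne, State.reg_setReg_self]
  have hr1 : s'.reg (r + 1) = w := State.reg_setReg_self ..
  have hstore := Exec.store s' a r (r + 1)
  have hcost := Nat.add_le_add (logCost_le v) (logCost_le w)
  have hfinal : ((s'.setMem a v w).setReg r 0).setReg (r + 1) 0 = s.setMem a v w := by
    simp only [s', ← State.setReg_setMem]
    rw [State.setReg_comm _ _ _ hne.symm, State.setReg_setReg, State.setReg_setReg,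
      State.setReg_eq_self (hclear r le_rfl), State.setReg_eq_self (hclear _ (Nat.le_succ r))]
  rw [hr, hr1] at hstore
  have hrun_assign := hrun.seq (hrun'.seq
    ((hstore.runs hcost).seq ((runs_clear _ r).seq (runs_clear _ (r + 1)))))
  rw [hfinal] at hrun_assign
  exact hrun_assign.mono (by omega)

end PolyTime

section AdjacencyMatrix

/-- An entry of the adjacency matrix of `splitGraph`: whether the vertex `x` is adjacent to the
vertex `n + i`, read off the code `f` of a hypergraph with `n` vertices and `m` edges. -/
def incEntry (n m : ℕ) (f : ℕ → ℕ) (i x : ℕ) : ℕ :=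
  if i < m then f (2 + (i * n + x)) else 1

/-- The entries of the adjacency matrix of `splitGraph`, computed from the code `f` of a hypergraph
with `n` vertices and `m` edges. -/
def adjEntry (n m : ℕ) (f : ℕ → ℕ) (u v : ℕ) : ℕ :=
  if u < n then if v < n then if u = v then 0 else 1 else incEntry n m f (v - n) u
  else if v < n then incEntry n m f (u - n) v else 0

/-- The code of `splitGraph` as an array, except that the entries of the adjacency matrix at
positions below `k` are still zero: the loops of `splitGraphProg` count down. -/
def partialCode (n m : ℕ) (f : ℕ → ℕ) (k : ℕ) : ℕ → ℕ
  | 0 => n + m + 1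
  | i + 1 =>
    if k ≤ i ∧ i < (n + m + 1) * (n + m + 1) then
      adjEntry n m f (i / (n + m + 1)) (i % (n + m + 1))
    else 0

variable {n m : ℕ} {f : ℕ → ℕ}

theorem adjEntry_le {M : ℕ} (hM : 1 ≤ M) (hf : ∀ i, f i ≤ M) (u v : ℕ) :
    adjEntry n m f u v ≤ M := by
  unfold adjEntry incEntry
  split_ifs <;> first | exact hf _ | omega

theorem partialCode_le (hf : ∀ i, f i ≤ n + m + 1) (k i : ℕ) :
    partialCode n m f k i ≤ n + m + 1 := by
  cases i with
  | zero => exact le_rfl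
  | succ i =>
    rw [partialCode]
    split_ifs
    · exact adjEntry_le (Nat.le_add_left ..) hf _ _
    · exact Nat.zero_le _

theorem partialCode_of_le {u v k : ℕ} (hu : u < n + m + 1) (hv : v < n + m + 1)
    (hk : k ≤ u * (n + m + 1) + v) :
    partialCode n m f k (1 + (u * (n + m + 1) + v)) = adjEntry n m f u v := by
  have hlt : u * (n + m + 1) + v < (n + m + 1) * (n + m + 1) := by nlinarith
  have hdiv : (u * (n + m + 1) + v) / (n + m + 1) = u ∧ (u * (n + m + 1) + v) % (n + m + 1) = v :=
    (Nat.div_mod_unique (Nat.add_pos_right _ one_pos)).2 ⟨by ring, hv⟩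
  rw [add_comm 1, partialCode, if_pos ⟨hk, hlt⟩, hdiv.1, hdiv.2]

theorem update_partialCode {u v : ℕ} (hu : u < n + m + 1) (hv : v < n + m + 1) :
    Function.update (partialCode n m f (u * (n + m + 1) + (v + 1)))
        (1 + (u * (n + m + 1) + v)) (adjEntry n m f u v) =
      partialCode n m f (u * (n + m + 1) + v) := by
  rw [Function.update_eq_iff]
  refine ⟨(partialCode_of_le hu hv le_rfl).symm, fun i hi => ?_⟩
  cases i with
  | zero => rfl
  | succ i =>
    rw [partialCode, partialCode]
    exact if_congr (by omega) rfl rfl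

variable {S : Fin m → Finset (Fin n)}

open Classical in
theorem incEntry_eq (hf : ∀ (j : Fin m) (x : Fin n), f (2 + (j * n + x)) = if x ∈ S j then 1 else 0)
    (i : ℕ) (x : Fin n) :
    incEntry n m f i x = if ∀ j : Fin m, i = j → x ∈ S j then 1 else 0 := by
  unfold incEntry
  split_ifs with hi h h
  · rw [hf ⟨i, hi⟩, if_pos (h ⟨i, hi⟩ rfl)]
  · refine (hf ⟨i, hi⟩ x).trans (if_neg fun hx => h fun j hj => ?_)
    rwa [show j = ⟨i, hi⟩ from Fin.ext hj.symm]
  · rfl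
  · exact absurd (fun j hj => absurd (hj ▸ j.2) hi) h

open Classical in
theorem incEntry_sub_eq
    (hf : ∀ (j : Fin m) (x : Fin n), f (2 + (j * n + x)) = if x ∈ S j then 1 else 0)
    {u v : Fin (n + m + 1)} (hu : n ≤ u.1) (hv : v.1 < n) :
    incEntry n m f (u - n) v = if (splitGraph S).Adj u v then 1 else 0 := by
  refine (incEntry_eq hf _ ⟨v, hv⟩).trans (if_congr ?_ rfl rfl)
  rw [adj_splitGraph_of_le S hu]
  constructor
  · exact fun h => ⟨⟨v, hv⟩, rfl, fun j hj => h j (by omega)⟩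
  · rintro ⟨x, hx, h⟩ j hj
    rw [show (⟨v, hv⟩ : Fin n) = x from Fin.ext hx]
    exact h j (by omega)

open Classical in
theorem adjEntry_eq (hf : ∀ (j : Fin m) (x : Fin n), f (2 + (j * n + x)) = if x ∈ S j then 1 else 0)
    (u v : Fin (n + m + 1)) :
    adjEntry n m f u v = if (splitGraph S).Adj u v then 1 else 0 := by
  unfold adjEntry
  rcases lt_or_ge u.1 n with hu | hu <;> rcases lt_or_ge v.1 n with hv | hv
  · rw [if_pos hu, if_pos hv]
    exact (ite_not ..).symm.trans
      (if_congr ((adj_splitGraph_of_lt S hu hv).trans Fin.ext_iff.not).symm rfl rfl)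
  · rw [if_pos hu, if_neg hv.not_gt, incEntry_sub_eq hf hv hu, SimpleGraph.adj_comm]
  · rw [if_neg hu.not_gt, if_pos hv, incEntry_sub_eq hf hu hv]
  · rw [if_neg hu.not_gt, if_neg hv.not_gt, if_neg]
    rw [adj_splitGraph_of_le S hu]
    rintro ⟨x, hx, -⟩
    omega

theorem isGraphCode_partialCode
    (hf : ∀ (j : Fin m) (x : Fin n), f (2 + (j * n + x)) = if x ∈ S j then 1 else 0) :
    IsGraphCode (splitGraph S) (partialCode n m f 0) := by
  refine ⟨rfl, fun u v => ?_, fun k hk => ?_⟩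
  · rw [partialCode_of_le u.2 v.2 (Nat.zero_le _), adjEntry_eq hf]
  · obtain ⟨i, rfl⟩ := Nat.exists_eq_add_of_le' hk
    rw [← add_assoc, add_right_comm, partialCode, if_neg (by omega)]

end AdjacencyMatrix

section SplitGraphProg

variable {r : ℕ}

/-- The expression for `incEntry`, the code of the hypergraph being in array `0`. -/
def incExpr (n m i x : Expr r) : Expr r :=
  .cond (m - i) (.get 0 (2 + (i * n + x))) 1

/-- The expression for `adjEntry`, the code of the hypergraph being in array `0`. -/
def adjExpr (n m u v : Expr r) : Expr r :=
  .cond (n - u)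
    (.cond (n - v) (.cond ((u - v) + (v - u)) 1 0) (incExpr n m (v - n) u))
    (.cond (n - v) (incExpr n m (u - n) v) 0)

theorem eval_incExpr (s : State) (n m i x : Expr r) :
    (incExpr n m i x).eval s =
      incEntry (n.eval s) (m.eval s) (s.mem 0) (i.eval s) (x.eval s) := by
  simp only [incExpr, incEntry, Expr.eval_cond_sub, Expr.eval, BinOp.eval]

theorem eval_adjExpr (s : State) (n m u v : Expr r) :
    (adjExpr n m u v).eval s =
      adjEntry (n.eval s) (m.eval s) (s.mem 0) (u.eval s) (v.eval s) := by
  simp only [adjExpr, adjEntry, Expr.eval_cond_sub, Expr.eval_cond_sub_add_sub, Expr.eval_sub,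
    eval_incExpr]
  rfl

/-- Read the numbers `n` of vertices and `m` of edges of the hypergraph into the registers `0` and
`1`, and put the number `n + m + 1` of vertices of `splitGraph` into register `2`. -/
def setupProg : Prog :=
  .seq (.assign (r := 5) 0 (.get 0 0)) (.seq (.assign (r := 5) 1 (.get 0 1))
    (.seq (.assign (r := 5) 2 (.reg 0 + .reg 1 + 1))
      (.seq (.assignCell (r := 5) 1 0 (.reg 2)) (.assign (r := 5) 3 (.reg 2)))))

/-- Start the next row of the adjacency matrix: the row index is in register `3`, and the column
index is in register `4`. -/
def rowProg : Prog :=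
  .seq (.assign (r := 5) 3 (.reg 3 - 1)) (.assign (r := 5) 4 (.reg 2))

/-- Write the next entry of the adjacency matrix to array `1`. -/
def entryProg : Prog :=
  .seq (.assign (r := 5) 4 (.reg 4 - 1))
    (.assignCell (r := 5) 1 (1 + (.reg 3 * .reg 2 + .reg 4))
      (adjExpr (.reg 0) (.reg 1) (.reg 3) (.reg 4)))

/-- Write the code of `splitGraph` to array `1`, the code of the hypergraph being in array `0`. -/
def splitGraphProg : Prog :=
  .seq setupProg (.loop 3 (.seq rowProg (.loop 4 entryProg)))

/-- The memory in the course of `splitGraphProg`, with row index `u` and column index `v`. -/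
def workState (n m : ℕ) (f : ℕ → ℕ) (u v k : ℕ) : State where
  reg
    | 0 => n
    | 1 => m
    | 2 => n + m + 1
    | 3 => u
    | 4 => v
    | _ => 0
  mem
    | 0 => f
    | 1 => partialCode n m f k
    | _ => 0

variable (n m : ℕ) (f : ℕ → ℕ)

theorem clearFrom_workState (u v k : ℕ) : (workState n m f u v k).ClearFrom 5 := by
  intro x hx
  obtain ⟨x, rfl⟩ := Nat.exists_eq_add_of_le' hx
  rfl

theorem workState_setReg_three (u u' v k : ℕ) :
    (workState n m f u v k).setReg 3 u' = workState n m f u' v k := by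
  refine State.ext (fun x => ?_) fun _ _ => rfl
  match x with
  | 0 | 1 | 2 | 3 | 4 | _ + 5 => rfl

theorem workState_setReg_four (u v v' k : ℕ) :
    (workState n m f u v k).setReg 4 v' = workState n m f u v' k := by
  refine State.ext (fun x => ?_) fun _ _ => rfl
  match x with
  | 0 | 1 | 2 | 3 | 4 | _ + 5 => rfl

variable {n m f}

theorem bounded_workState (hf : ∀ i, f i ≤ n + m + 1) {u v : ℕ} (hu : u ≤ n + m + 1)
    (hv : v ≤ n + m + 1) (k : ℕ) : (workState n m f u v k).Bounded (n + m + 1) := by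
  constructor
  · intro x
    match x with
    | 0 | 1 | 2 | 3 | 4 | _ + 5 => simp only [workState]; omega
  · intro a i
    match a with
    | 0 => exact hf i
    | 1 => exact partialCode_le hf k i
    | _ + 2 => exact Nat.zero_le _

theorem bounded_init {M : ℕ} (hf : ∀ i, f i ≤ M) : (State.init f).Bounded M := by
  refine ⟨fun _ => Nat.zero_le M, fun a i => ?_⟩
  match a with
  | 0 => exact hf i
  | _ + 1 => exact Nat.zero_le M

theorem setMem_workState {u v : ℕ} (hu : u < n + m + 1) (hv : v < n + m + 1) :
    (workState n m f u v (u * (n + m + 1) + (v + 1))).setMem 1 (1 + (u * (n + m + 1) + v))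
      (adjEntry n m f u v) = workState n m f u v (u * (n + m + 1) + v) := by
  refine State.ext (fun _ => rfl) fun a i => ?_
  match a with
  | 0 | _ + 2 => rfl
  | 1 => exact congrFun (update_partialCode hu hv) i

theorem exists_polyTime_setupProg : ∃ F, PolyTime 5 setupProg F ∧ ∀ n m f, f 0 = n → f 1 = m →
    F (State.init f) = workState n m f (n + m + 1) 0 ((n + m + 1) * (n + m + 1)) := by
  refine ⟨_, (polyTime_assign _ _).seq ((polyTime_assign _ _).seq ((polyTime_assign _ _).seq
    ((polyTime_assignCell _ _ _).seq (polyTime_assign _ _)))), ?_⟩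
  rintro n m f rfl rfl
  refine State.ext (fun x => ?_) fun a i => ?_
  · match x with
    | 0 | 1 | 2 | 3 | 4 | _ + 5 => rfl
  · match a, i with
    | 0, _ | _ + 2, _ | 1, 0 => rfl
    | 1, i + 1 => exact (if_neg (by omega)).symm

theorem exists_polyTime_rowProg : ∃ F, PolyTime 5 rowProg F ∧ ∀ n m f u v k,
    F (workState n m f (u + 1) v k) = workState n m f u (n + m + 1) k := by
  refine ⟨_, (polyTime_assign _ _).seq (polyTime_assign _ _), fun n m f u v k => ?_⟩
  exact (congrArg (State.setReg · 4 _) (workState_setReg_three ..)).trans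
    (workState_setReg_four ..)

theorem exists_polyTime_entryProg : ∃ F, PolyTime 5 entryProg F ∧ ∀ n m f u v,
    u < n + m + 1 → v < n + m + 1 →
      F (workState n m f u (v + 1) (u * (n + m + 1) + (v + 1))) =
        workState n m f u v (u * (n + m + 1) + v) := by
  refine ⟨_, (polyTime_assign _ _).seq (polyTime_assignCell _ _ _), fun n m f u v hu hv => ?_⟩
  have hassign : (workState n m f u (v + 1) (u * (n + m + 1) + (v + 1))).setReg 4 v =
    workState n m f u v (u * (n + m + 1) + (v + 1)) := workState_setReg_four ..
  refine Eq.trans ?_ (setMem_workState hu hv)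
  rw [← hassign]
  simp only [Function.comp_apply, eval_adjExpr]
  rfl

theorem exists_runs_splitGraphProg : ∃ q : Polynomial ℕ, ∀ (n m : ℕ) (f : ℕ → ℕ), f 0 = n →
    f 1 = m → (∀ i, f i ≤ n + m + 1) →
      Runs splitGraphProg (State.init f) (q.eval (n + m + 1)) (workState n m f 0 0 0) := by
  obtain ⟨F, ⟨q, hq⟩, hF⟩ := exists_polyTime_setupProg
  obtain ⟨F₁, ⟨q₁, hq₁⟩, hF₁⟩ := exists_polyTime_rowProg
  obtain ⟨F₂, ⟨q₂, hq₂⟩, hF₂⟩ := exists_polyTime_entryProg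
  refine ⟨q + (.X + 1) * (q₁ + (.X + 1) * (q₂ + .X + 1) + .X + 1), fun n m f h0 h1 hf => ?_⟩
  have hsetup := (hq (s := State.init f) (fun _ _ => rfl) (bounded_init hf)).2.2
  have hentry : ∀ u < n + m + 1, ∀ v < n + m + 1,
      Runs entryProg (workState n m f u (v + 1) (u * (n + m + 1) + (v + 1)))
        (q₂.eval (n + m + 1)) (workState n m f u v (u * (n + m + 1) + v)) := fun u hu v hv => by
    rw [← hF₂ n m f u v hu hv]
    exact (hq₂ (clearFrom_workState _ _ _ _ _ _) (bounded_workState hf hu.le hv _)).2.2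
  have hrow : ∀ u < n + m + 1,
      Runs rowProg (workState n m f (u + 1) 0 ((u + 1) * (n + m + 1))) (q₁.eval (n + m + 1))
        (workState n m f u (n + m + 1) (u * (n + m + 1) + (n + m + 1))) := fun u hu => by
    rw [← Nat.succ_mul, ← hF₁ n m f u 0]
    exact (hq₁ (clearFrom_workState _ _ _ _ _ _) (bounded_workState hf hu (Nat.zero_le _) _)).2.2
  have hloop := Runs.countdown (S := fun u => workState n m f u 0 (u * (n + m + 1))) (x := 3)
    (fun _ => rfl) fun u hu => (hrow u hu).seq
      (Runs.countdown (S := fun v => workState n m f u v (u * (n + m + 1) + v)) (x := 4)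
        (fun _ => rfl) (hentry u hu))
  rw [hF n m f h0 h1] at hsetup
  simpa only [splitGraphProg, Polynomial.eval_add, Polynomial.eval_mul, Polynomial.eval_X,
    Polynomial.eval_one, Nat.zero_mul] using hsetup.seq hloop

end SplitGraphProg

section Reduction

variable {n m : ℕ} {E : Finset (Finset (Fin n))} {f : ℕ → ℕ}

theorem IsHypergraphCode.le (hf : IsHypergraphCode E f) (i : ℕ) : f i ≤ n + E.card + 1 := by
  obtain ⟨e, h0, h1, hinc, hzero⟩ := hf
  match i with
  | 0 => omega
  | 1 => omega
  | k + 2 =>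
    suffices h : f (2 + k) ≤ 1 by rw [add_comm]; omega
    by_cases hk : k < E.card * n
    · have hn : 0 < n := Nat.pos_of_mul_pos_left (Nat.zero_lt_of_lt hk)
      have hcell := hinc ⟨k / n, Nat.div_lt_of_lt_mul (by rwa [mul_comm])⟩ ⟨k % n, Nat.mod_lt _ hn⟩
      rw [Nat.div_add_mod'] at hcell
      rw [hcell]
      split_ifs <;> omega
    · rw [hzero _ (by omega)]
      exact zero_le_one

theorem toNats_map_vertexEmb (H : Finset (Fin n)) : toNats (H.map (vertexEmb n m)) = toNats H :=
  Finset.map_map ..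

theorem sol_splitGraph (hE : E.Nonempty) {S : Fin m → Finset (Fin n)}
    (hS : Set.range S = E) :
    minimalCDSInSplitGraphs.sol ⟨n + m + 1, splitGraph S, isSplit_splitGraph S⟩ =
      minimalHittingSets.sol ⟨n, E⟩ := by
  ext D
  constructor
  · rintro ⟨_, hD, rfl⟩
    obtain ⟨H, hH, rfl⟩ := (minimal_isCDS_splitGraph_iff S hE hS _).1 hD
    exact ⟨H, hH, toNats_map_vertexEmb H⟩
  · rintro ⟨H, hH, rfl⟩
    exact ⟨_, (minimal_isCDS_splitGraph_iff S hE hS _).2 ⟨H, hH, rfl⟩,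
      (toNats_map_vertexEmb H).symm⟩

theorem sol_empty : minimalHittingSets.sol ⟨n, ∅⟩ = {∅} := by
  have hbot : ∀ H : Finset (Fin n), Minimal (IsHittingSet ∅) H ↔ H = ∅ := fun H =>
    minimal_iff_eq (fun F hF => absurd hF (Finset.notMem_empty F)) fun _ _ => bot_le
  ext D
  simp [minimalHittingSets, hbot, toNats]

theorem comap_workState (f : ℕ → ℕ) :
    (workState n m f 0 0 0).comap (· + 5) (· + 1) = State.init (partialCode n m f 0) := by
  refine State.ext (fun _ => rfl) fun a i => ?_
  match a with
  | 0 | _ + 1 => rfl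

/-- Enumerate the minimal hitting sets by means of a program `c` for minimal connected dominating
sets, run on `splitGraph` in a memory disjoint from that of `splitGraphProg`. -/
def hittingSetProg (c : Prog) : Prog :=
  .seq splitGraphProg (.ite 1 (c.rename (· + 5) (· + 1)) .emit)

theorem Enumerates.hittingSetProg {c : Prog} {T T' : ℕ}
    (hc : ∀ (G : SimpleGraph (Fin (n + E.card + 1))) (hG : IsSplit G) (g : ℕ → ℕ),
      IsGraphCode G g → Enumerates c (State.init g) (minimalCDSInSplitGraphs.sol ⟨_, G, hG⟩) T')
    (hf : IsHypergraphCode E f)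
    (hrun : Runs splitGraphProg (State.init f) T (workState n E.card f 0 0 0)) :
    Enumerates (hittingSetProg c) (State.init f) (minimalHittingSets.sol ⟨n, E⟩)
      (T + (logCost E.card + (T' + 1))) := by
  refine hrun.seq_enumerates ?_
  rcases E.eq_empty_or_nonempty with rfl | hE
  · rw [sol_empty]
    exact .ite_false rfl ((enumerates_emit _).mono (Nat.le_add_left ..))
  · obtain ⟨e, -, -, hinc, -⟩ := hf
    have hrange : Set.range (fun j => (e j).1) = E :=
      (e.surjective.range_comp Subtype.val).trans Subtype.range_coe
    rw [← sol_splitGraph hE hrange]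
    have henum := hc _ (isSplit_splitGraph _) _ (isGraphCode_partialCode hinc)
    rw [← comap_workState] at henum
    exact .ite_true hE.card_ne_zero
      ((henum.rename (add_left_injective 5) (add_left_injective 1)).mono (Nat.le_succ _))

end Reduction

end PolyDelay

theorem mainTheorem7
    (h : PolyDelay.minimalCDSInSplitGraphs.HasPolyDelayAlgorithm) :
    PolyDelay.minimalHittingSets.HasPolyDelayAlgorithm := by
  obtain ⟨c, p, hc⟩ := h
  obtain ⟨q, hq⟩ := PolyDelay.exists_runs_splitGraphProg
  refine ⟨PolyDelay.hittingSetProg c, (q + .X + p + 1).comp (.X + 1), ?_⟩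
  rintro ⟨n, E⟩ f hf
  have ⟨_, hn, hm, _⟩ := hf
  have hrun := hq n E.card f hn hm hf.le
  have henum := PolyDelay.Enumerates.hittingSetProg (c := c) (T' := p.eval (n + E.card + 1))
    (fun G hG g hg => hc ⟨n + E.card + 1, G, hG⟩ g hg) hf hrun
  refine henum.mono ?_
  have hlog := PolyDelay.logCost_le E.card
  simp only [PolyDelay.minimalHittingSets, Polynomial.eval_comp, Polynomial.eval_add,
    Polynomial.eval_X, Polynomial.eval_one]
  omega
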